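/- Fix an integer $k \ge 0$. All graphs are finite, simple and connected; a graph $G$ on $n$ vertices is $3$-connected if $n \ge 4$ and $G \setminus X$ is connected for every set $X$ of two vertices. The vertices of $G$ carry pairwise distinct identifiers in $\{1,\dots,n^k\}$. An assignment gives a finite binary string (label) to every vertex and to every edge of $G$. A verifier is a fixed function, the same for all graphs, by which each vertex accepts or rejects as a function only of its own identifier and label and of the set of triples (identifier of $w$, label of $w$, label of the edge $vw$) over its neighbours $w$. Then $3$-connected graphs can be certified with labels of $O(\log n)$ bits on the vertices and $O(1)$ bits on the edges: there are functions $f, g : \mathbb{N} \to \mathbb{N}$ with $f(n) = O(\log n)$ and $g(n) = O(1)$, and a verifier, such that for every connected graph $G$ on $n$ vertices and every such choice of identifiers: 1. if $G$ is $3$-connected, then there is an assignment with labels of at most $f(n)$ bits on the vertices and at most $g(n)$ bits on the edges for which all vertices accept; 2. if $G$ is not $3$-connected, then for every assignment, with labels of any size, at least one vertex rejects. -/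

import Mathlib

namespace LocalCert

/-- `G` is `k`-(vertex-)connected: it has more than `k` vertices, and there is no set `X` of `k - 1`
vertices such that `G ∖ X` is not connected. -/
def IsKConnected {V : Type} [Fintype V] (k : ℕ) (G : SimpleGraph V) : Prop :=
  k < Fintype.card V ∧
    ∀ X : Finset V, X.card + 1 = k → (G.induce {v : V | v ∉ X}).Connected

/-- A certificate (label) is a finite string of bits; its size is its length. -/
abbrev Label : Type := List Bool

/-- What a node sees at distance 1 in an edge certification: its own identifier and label, and, for
each neighbour, the triple (identifier of the neighbour, label of the neighbour, label of the edge
that joins them). -/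
structure View where
  ident : ℕ
  label : Label
  nbrs : Set (ℕ × Label × Label)

/-- The view of the node `v` in the graph `G` with identifiers `ident`, node labels `c` and (symmetric)
edge labels `e`; only the values of `e` on edges of `G` are ever read. -/
def view {V : Type} (G : SimpleGraph V) (ident : V → ℕ) (c : V → Label) (e : Sym2 V → Label)
    (v : V) : View where
  ident := ident v
  label := c v
  nbrs := {t | ∃ w, G.Adj v w ∧ t = (ident w, c w, e s(v, w))}

/-- A verifier: each node outputs accept (`True`) or reject (`False`), as a function of its view only. -/
abbrev Verifier : Type := View → Prop

/-- The verifier accepts an instance when every node outputs accept. -/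
def Verifier.Accepts (A : Verifier) {V : Type} (G : SimpleGraph V) (ident : V → ℕ)
    (c : V → Label) (e : Sym2 V → Label) : Prop :=
  ∀ v, A (view G ident c e v)

/-- Unique identifiers in the polynomial range `[1, n ^ k]`, where `n` is the number of nodes. -/
def IsIdent {V : Type} [Fintype V] (k : ℕ) (ident : V → ℕ) : Prop :=
  Function.Injective ident ∧ ∀ v, 1 ≤ ident v ∧ ident v ≤ Fintype.card V ^ k

/-- The class `C` of graphs can be certified, among connected graphs with identifiers in `[1, n ^ k]`,
with labels of at most `f n` bits on the nodes and at most `g n` bits on the edges. One verifier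
serves all graphs. The size bounds apply to the labels that the prover gives to the graphs of `C`;
on connected graphs outside `C` no labels of any size are accepted. -/
def CertifiableWith (k : ℕ) (C : ∀ {V : Type} [Fintype V], SimpleGraph V → Prop)
    (f g : ℕ → ℕ) : Prop :=
  ∃ A : Verifier, ∀ (V : Type) [Fintype V] (G : SimpleGraph V) (ident : V → ℕ),
    G.Connected → IsIdent k ident →
      (C G → ∃ (c : V → Label) (e : Sym2 V → Label),
        (∀ v, (c v).length ≤ f (Fintype.card V)) ∧
        (∀ a ∈ G.edgeSet, (e a).length ≤ g (Fintype.card V)) ∧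
        A.Accepts G ident c e) ∧
      (¬ C G → ∀ (c : V → Label) (e : Sym2 V → Label), ¬ A.Accepts G ident c e)

end LocalCert

/-!
A three-routing towards a root `r` is a pair of orders `p`, `q` on the vertices such that every
vertex that is neither `r` nor a neighbour of `r` has a neighbour below it in `p`, a neighbour above
it in `p`, neither of them above it in `q`, and a neighbour above it in `q`. Walking down, up or out
leads to `r` along three routes that meet only at their start, so two removed vertices spare one of
them. Since two removed vertices also spare one of four distinct roots, a graph with four such
routings is 3-connected. Each vertex can check its own condition from the ranks of its neighbours in
the two orders, which take `O(log n)` bits, so that the edges need no labels.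

A 3-connected graph has a three-routing towards every root `r`. Start from `r` and one of its
neighbours, and reserve another neighbour `u` of `r`. Add ears to the set of placed vertices one
after another, each of them chosen so that the remaining vertices stay connected and every vertex
of the ear keeps a neighbour among them: `q` is the index of the ear, and the values of `p` along
an ear are inserted between those of its two attachments. Such an ear is found outside a maximal
connected set `D` that contains `u` and spares some ear. If a vertex outside `D` and the placed
set `A` had no neighbour in `D`, a component of the vertices without such a neighbour would, by
the maximality of `D`, have at most two neighbours, against 3-connectivity.
-/

namespace LocalCert

open SimpleGraph

section ReachIn

variable {V : Type*} {G : SimpleGraph V} {X Y : Set V} {s t u v : V}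

/-- `s` and `t` are joined by a walk of `G` inside `Y`. This is reachability in `G.induce Y`, stated
for vertices of `G` so that `Y` can vary. -/
def ReachIn (G : SimpleGraph V) (Y : Set V) (s t : V) : Prop :=
  ∃ w : G.Walk s t, ∀ x ∈ w.support, x ∈ Y

lemma ReachIn.refl (hs : s ∈ Y) : ReachIn G Y s s :=
  ⟨Walk.nil, by simpa using hs⟩

lemma ReachIn.symm (h : ReachIn G Y s t) : ReachIn G Y t s := by
  obtain ⟨w, hw⟩ := h
  exact ⟨w.reverse, by simpa using hw⟩

lemma ReachIn.trans (hst : ReachIn G Y s t) (htu : ReachIn G Y t u) : ReachIn G Y s u := by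
  obtain ⟨w, hw⟩ := hst
  obtain ⟨w', hw'⟩ := htu
  exact ⟨w.append w', fun x hx => ((Walk.mem_support_append_iff w w').1 hx).elim (hw x) (hw' x)⟩

lemma ReachIn.mono (hXY : X ⊆ Y) (h : ReachIn G X s t) : ReachIn G Y s t := by
  obtain ⟨w, hw⟩ := h
  exact ⟨w, fun x hx => hXY (hw x hx)⟩

lemma ReachIn.mem_left (h : ReachIn G Y s t) : s ∈ Y := by
  obtain ⟨w, hw⟩ := h
  exact hw s w.start_mem_support

lemma ReachIn.mem_right (h : ReachIn G Y s t) : t ∈ Y :=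
  h.symm.mem_left

lemma ReachIn.of_adj (h : G.Adj s t) (hs : s ∈ Y) (ht : t ∈ Y) : ReachIn G Y s t :=
  ⟨h.toWalk, by simp [hs, ht]⟩

lemma ReachIn.exists_adj_of_mem_of_notMem (h : ReachIn G Y s t) (hs : s ∈ X) (ht : t ∉ X) :
    ∃ x ∈ X ∩ Y, ∃ y ∈ Y \ X, G.Adj x y := by
  obtain ⟨w, hw⟩ := h
  obtain ⟨d, hd, hdX, hdX'⟩ := w.exists_boundary_dart X hs ht
  exact ⟨d.fst, ⟨hdX, hw _ (w.dart_fst_mem_support_of_mem_darts hd)⟩,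
    d.snd, ⟨hw _ (w.dart_snd_mem_support_of_mem_darts hd), hdX'⟩, d.adj⟩

lemma reachIn_of_connected_induce (h : (G.induce Y).Connected) (hs : s ∈ Y) (ht : t ∈ Y) :
    ReachIn G Y s t := by
  obtain ⟨w⟩ := h.preconnected ⟨s, hs⟩ ⟨t, ht⟩
  refine ⟨w.map (Embedding.induce Y).toHom, fun x hx => ?_⟩
  obtain ⟨y, -, rfl⟩ := List.mem_map.1 (Walk.support_map (Embedding.induce Y).toHom w ▸ hx)
  exact y.2

lemma connected_induce_of_reachIn (ht : t ∈ Y) (h : ∀ v ∈ Y, ReachIn G Y t v) :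
    (G.induce Y).Connected := by
  refine (connected_iff_exists_forall_reachable _).2 ⟨⟨t, ht⟩, fun ⟨v, hv⟩ => ?_⟩
  obtain ⟨w, hw⟩ := h v hv
  exact ⟨w.induce Y hw⟩

lemma reachIn_getVert_of_lt {w : G.Walk s t} (hw : w.IsPath) (hwY : ∀ x ∈ w.support, x ∈ Y)
    {i j : ℕ} (hij : i < j) (hj : j ≤ w.length) :
    ReachIn G (Y \ {w.getVert j}) s (w.getVert i) := by
  refine ⟨w.take i, fun x hx => ?_⟩
  obtain ⟨n, rfl, -⟩ := Walk.mem_support_iff_exists_getVert.1 hx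
  rw [Walk.take_getVert]
  refine ⟨hwY _ (w.getVert_mem_support _), fun h => ?_⟩
  have := hw.getVert_injOn (show min i n ≤ w.length by omega) hj h
  omega

lemma getVert_reachIn_of_lt {w : G.Walk s t} (hw : w.IsPath) (hwY : ∀ x ∈ w.support, x ∈ Y)
    {i j : ℕ} (hij : i < j) (hj : j ≤ w.length) :
    ReachIn G (Y \ {w.getVert i}) (w.getVert j) t := by
  refine ⟨w.drop j, fun x hx => ?_⟩
  obtain ⟨n, rfl, hn⟩ := Walk.mem_support_iff_exists_getVert.1 hx
  rw [Walk.drop_length] at hn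
  rw [Walk.drop_getVert]
  refine ⟨hwY _ (w.getVert_mem_support _), fun h => ?_⟩
  have := hw.getVert_injOn (show j + n ≤ w.length by omega) (show i ≤ w.length by omega) h
  omega

/-- `d` has a neighbour in the component of `k` in `G.induce Y`. -/
def AttachedIn (G : SimpleGraph V) (Y : Set V) (d k : V) : Prop :=
  ∃ s, G.Adj d s ∧ ReachIn G Y s k

lemma AttachedIn.mono (hXY : X ⊆ Y) (h : AttachedIn G X u v) : AttachedIn G Y u v := by
  obtain ⟨s, hs, hsv⟩ := h
  exact ⟨s, hs, hsv.mono hXY⟩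

lemma AttachedIn.reachIn (h : AttachedIn G Y u v) (hu : u ∈ Y) : ReachIn G Y u v := by
  obtain ⟨s, hs, hsv⟩ := h
  exact (ReachIn.of_adj hs hu hsv.mem_left).trans hsv

/-- The neighbourhood of the component of `k` in `G.induce Y`. -/
def boundary (G : SimpleGraph V) (Y : Set V) (k : V) : Set V :=
  {d | d ∉ Y ∧ AttachedIn G Y d k}

end ReachIn

section IsKConnected

variable {V : Type} [Fintype V] {G : SimpleGraph V} {k : ℕ}

lemma IsKConnected.reachIn_compl (hG : IsKConnected k G) {X : Finset V} (hX : X.card < k)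
    {s t : V} (hs : s ∉ X) (ht : t ∉ X) : ReachIn G {v | v ∉ X} s t := by
  classical
  have hst : k - 1 ≤ ({s, t}ᶜ : Finset V).card := by
    have := hG.1
    have := Finset.card_le_two (a := s) (b := t)
    rw [Finset.card_compl]
    omega
  obtain ⟨X', hXX', hX', hcard⟩ := Finset.exists_subsuperset_card_eq (t := {s, t}ᶜ)
    (Finset.subset_compl_comm.1 (by simp [Finset.insert_subset_iff, hs, ht]))
    (Nat.le_sub_one_of_lt hX) hst
  have hsX' : s ∉ X' := fun h => by simpa using hX' h
  have htX' : t ∉ X' := fun h => by simpa using hX' h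
  exact (reachIn_of_connected_induce (hG.2 X' (by omega)) hsX' htX').mono
    fun v (hv : v ∉ X') h => hv (hXX' h)

lemma IsKConnected.le_ncard_boundary (hG : IsKConnected k G) {Y : Set V} (hY : k ≤ Yᶜ.ncard)
    {c : V} (hc : c ∈ Y) : k ≤ (boundary G Y c).ncard := by
  classical
  by_contra! hlt
  obtain ⟨o, hoY, ho⟩ := Set.exists_mem_notMem_of_ncard_lt_ncard (hlt.trans_le hY)
  have hcompl := hG.reachIn_compl (X := (boundary G Y c).toFinset) (s := c) (t := o)
    (by rwa [← Set.ncard_eq_toFinset_card']) (fun h => (Set.mem_toFinset.1 h).1 hc) (by simpa)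
  obtain ⟨x, ⟨hx, -⟩, d, ⟨hd, hdc⟩, hxd⟩ := hcompl.exists_adj_of_mem_of_notMem
    (X := {x | ReachIn G Y x c}) (ReachIn.refl hc) fun h => hoY h.mem_left
  have hdx : AttachedIn G Y d c := ⟨x, hxd.symm, hx⟩
  exact hd (Set.mem_toFinset.2 ⟨fun hdY => hdc (hdx.reachIn hdY), hdx⟩)

lemma IsKConnected.nontrivial_neighborSet (hG : IsKConnected 3 G) (v : V) :
    (G.neighborSet v).Nontrivial := by
  have hcompl : 3 ≤ ({v}ᶜ : Set V).ncard := by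
    have := hG.1
    rw [Set.ncard_compl, Set.ncard_singleton, Nat.card_eq_fintype_card]
    omega
  have hboundary : boundary G {v} v ⊆ G.neighborSet v := by
    rintro d ⟨-, s, hds, hs⟩
    obtain rfl : s = v := hs.mem_left
    exact hds.symm
  rw [← Set.one_lt_ncard_iff_nontrivial]
  have := (hG.le_ncard_boundary hcompl rfl).trans (Set.ncard_le_ncard hboundary)
  omega

end IsKConnected

section Ears

variable {V : Type*} {G : SimpleGraph V} {A X Y Z : Set V} {a b d k s t z : V} {w : G.Walk s t}
  {i j l : ℕ}

/-- `w` is the interior of an ear of `A`: a path inside `Y` whose ends are attached to two distinct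
vertices `a` and `b` of `A`. -/
structure IsEar (G : SimpleGraph V) (A Y : Set V) (a b : V) {s t : V} (w : G.Walk s t) : Prop where
  left_mem : a ∈ A
  right_mem : b ∈ A
  ne : a ≠ b
  adj_left : G.Adj a s
  adj_right : G.Adj b t
  isPath : w.IsPath
  mem_of_mem_support : ∀ x ∈ w.support, x ∈ Y

/-- Some ear of `A` has its interior in `Y`. -/
def HasEar (G : SimpleGraph V) (A Y : Set V) : Prop :=
  ∃ (a b s t : V) (w : G.Walk s t), IsEar G A Y a b w

lemma IsEar.reverse (h : IsEar G A Y a b w) : IsEar G A Y b a w.reverse where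
  left_mem := h.right_mem
  right_mem := h.left_mem
  ne := h.ne.symm
  adj_left := h.adj_right
  adj_right := h.adj_left
  isPath := h.isPath.reverse
  mem_of_mem_support := by simpa using h.mem_of_mem_support

lemma hasEar_of_attachedIn (ha : a ∈ A) (hb : b ∈ A) (hab : a ≠ b) (hak : AttachedIn G Y a k)
    (hbk : AttachedIn G Y b k) : HasEar G A Y := by
  classical
  obtain ⟨s, has, hsk⟩ := hak
  obtain ⟨t, hbt, htk⟩ := hbk
  obtain ⟨w, hw⟩ := hsk.trans htk.symm
  exact ⟨a, b, s, t, w.bypass, ha, hb, hab, has, hbt, w.bypass_isPath,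
    fun x hx => hw x (w.support_bypass_subset_support hx)⟩

lemma eq_of_attachedIn_of_not_hasEar (h : ¬ HasEar G A Y) (ha : a ∈ A) (hb : b ∈ A)
    (hak : AttachedIn G Y a k) (hbk : AttachedIn G Y b k) : a = b := by
  by_contra hab
  exact h (hasEar_of_attachedIn ha hb hab hak hbk)

lemma IsEar.exists_getVert_eq_of_not_hasEar (h : IsEar G A Y a b w)
    (hz : ¬ HasEar G A (Y \ {z})) : ∃ i ≤ w.length, w.getVert i = z := by
  by_contra! hzw
  refine hz ⟨a, b, s, t, w, { h with
    mem_of_mem_support := fun x hx => ⟨h.mem_of_mem_support x hx, ?_⟩ }⟩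
  obtain ⟨i, rfl, hi⟩ := Walk.mem_support_iff_exists_getVert.1 hx
  exact hzw i hi

lemma IsEar.attachedIn_left (h : IsEar G A Y a b w) (hij : i < j) (hj : j ≤ w.length)
    (hk : ReachIn G (Y \ {w.getVert j}) (w.getVert i) k) :
    AttachedIn G (Y \ {w.getVert j}) a k :=
  ⟨s, h.adj_left, (reachIn_getVert_of_lt h.isPath h.mem_of_mem_support hij hj).trans hk⟩

lemma IsEar.attachedIn_right (h : IsEar G A Y a b w) (hij : i < j) (hj : j ≤ w.length)
    (hk : ReachIn G (Y \ {w.getVert i}) (w.getVert j) k) :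
    AttachedIn G (Y \ {w.getVert i}) b k :=
  ⟨t, h.adj_right, (getVert_reachIn_of_lt h.isPath h.mem_of_mem_support hij hj).symm.trans hk⟩

lemma AttachedIn.diff_singleton (h : AttachedIn G (Y \ Z) d k) (hz : z ∈ Z) :
    AttachedIn G (Y \ {z}) d k :=
  h.mono (Set.sdiff_subset_sdiff_right (Set.singleton_subset_iff.2 hz))

/-- The component of `k` in `Y \ Z` would otherwise let the ear from `a` to `b` bypass its middle
vertex. -/
lemma IsEar.not_attachedIn_three (h : IsEar G A Y a b w) (hZ : ∀ z ∈ Z, ¬ HasEar G A (Y \ {z}))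
    (hij : i < j) (hjl : j < l) (hl : l ≤ w.length) (hi : AttachedIn G (Y \ Z) (w.getVert i) k)
    (hj : w.getVert j ∈ Z) : ¬ AttachedIn G (Y \ Z) (w.getVert l) k := by
  intro hlk
  have hmem : ∀ n ≤ w.length, n ≠ j → w.getVert n ∈ Y \ {w.getVert j} := fun n hn hnj =>
    ⟨h.mem_of_mem_support _ (w.getVert_mem_support n),
      fun hnj' => hnj (h.isPath.getVert_injOn hn (hjl.le.trans hl) hnj')⟩
  refine h.ne (eq_of_attachedIn_of_not_hasEar (k := k) (hZ _ hj) h.left_mem h.right_mem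
    (h.attachedIn_left hij (hjl.le.trans hl) ?_) (h.attachedIn_right hjl hl ?_))
  · exact (hi.diff_singleton hj).reachIn (hmem i (by omega) hij.ne)
  · exact (hlk.diff_singleton hj).reachIn (hmem l hl hjl.ne')

/-- Otherwise `d` could replace `b`, giving an ear that avoids `w.getVert j`, and also `a`, giving
an ear that avoids `w.getVert i`. -/
lemma IsEar.not_attachedIn_two (h : IsEar G A Y a b w) (hZ : ∀ z ∈ Z, ¬ HasEar G A (Y \ {z}))
    (hij : i < j) (hj : j ≤ w.length) (hiZ : w.getVert i ∈ Z) (hjZ : w.getVert j ∈ Z)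
    (hik : AttachedIn G (Y \ Z) (w.getVert i) k) (hjk : AttachedIn G (Y \ Z) (w.getVert j) k)
    (hd : d ∈ A) : ¬ AttachedIn G (Y \ Z) d k := by
  intro hdk
  have hne : w.getVert i ≠ w.getVert j := fun hij' =>
    hij.ne (h.isPath.getVert_injOn (hij.le.trans hj) hj hij')
  have hmem : ∀ n, w.getVert n ∈ Y := fun n => h.mem_of_mem_support _ (w.getVert_mem_support n)
  have had : a = d := eq_of_attachedIn_of_not_hasEar (hZ _ hjZ) h.left_mem hd
    (h.attachedIn_left hij hj ((hik.diff_singleton hjZ).reachIn ⟨hmem i, hne⟩))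
    (hdk.diff_singleton hjZ)
  have hbd : b = d := eq_of_attachedIn_of_not_hasEar (hZ _ hiZ) h.right_mem hd
    (h.attachedIn_right hij hj ((hjk.diff_singleton hiZ).reachIn ⟨hmem j, hne.symm⟩))
    (hdk.diff_singleton hiZ)
  exact h.ne (had.trans hbd.symm)

lemma IsEar.ncard_boundary_le_two [Finite V] (h : IsEar G A Y a b w) (hZne : Z.Nonempty)
    (hZ : ∀ z ∈ Z, ¬ HasEar G A (Y \ {z})) (hAZ : boundary G (Y \ Z) k ⊆ A ∪ Z) :
    (boundary G (Y \ Z) k).ncard ≤ 2 := by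
  have hAA : ∀ d ∈ A, ∀ d' ∈ A, AttachedIn G (Y \ Z) d k → AttachedIn G (Y \ Z) d' k → d = d' := by
    obtain ⟨z, hz⟩ := hZne
    exact fun d hd d' hd' hdk hdk' => eq_of_attachedIn_of_not_hasEar (hZ z hz) hd hd'
      (hdk.diff_singleton hz) (hdk'.diff_singleton hz)
  have hindex : ∀ z ∈ Z, ∃ i ≤ w.length, w.getVert i = z := fun z hz =>
    h.exists_getVert_eq_of_not_hasEar (hZ z hz)
  have hZZA : ∀ z ∈ Z, ∀ z' ∈ Z, ∀ d ∈ A, z ≠ z' → AttachedIn G (Y \ Z) z k →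
      AttachedIn G (Y \ Z) z' k → ¬ AttachedIn G (Y \ Z) d k := by
    intro z hz z' hz' d hd hzz' hzk hzk'
    obtain ⟨i, hi, rfl⟩ := hindex z hz
    obtain ⟨j, hj, rfl⟩ := hindex z' hz'
    rcases lt_or_gt_of_ne (ne_of_apply_ne _ hzz') with hij | hij
    · exact h.not_attachedIn_two hZ hij hj hz hz' hzk hzk' hd
    · exact h.not_attachedIn_two hZ hij hi hz' hz hzk' hzk hd
  have hZZZ : ∀ z ∈ Z, ∀ z' ∈ Z, ∀ z'' ∈ Z, z ≠ z' → z ≠ z'' → z' ≠ z'' →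
      AttachedIn G (Y \ Z) z k → AttachedIn G (Y \ Z) z' k → ¬ AttachedIn G (Y \ Z) z'' k := by
    intro z hz z' hz' z'' hz'' h₁ h₂ h₃
    obtain ⟨i, hi, rfl⟩ := hindex z hz
    obtain ⟨j, hj, rfl⟩ := hindex z' hz'
    obtain ⟨l, hl, rfl⟩ := hindex z'' hz''
    have hbetween := fun {i j l : ℕ} (hij : i < j) (hjl : j < l) (hl : l ≤ w.length) hi hj =>
      h.not_attachedIn_three (k := k) hZ hij hjl hl hi hj
    grind
  by_contra! hlt
  obtain ⟨x, hx, y, hy, z, hz, hxy, hxz, hyz⟩ := (Set.two_lt_ncard).1 hlt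
  have hxk := hx.2
  have hyk := hy.2
  have hzk := hz.2
  rcases hAZ hx with hx | hx <;> rcases hAZ hy with hy | hy <;> rcases hAZ hz with hz | hz <;>
    grind

end Ears

section NonseparatingEars

variable {V : Type*} {G : SimpleGraph V} {A D : Set V} {a b k s t u z : V} {w : G.Walk s t}

/-- `D` is a connected set containing `u` and disjoint from `A` whose removal leaves an ear of `A`.
The ears left by a maximal such `D` are nonseparating. -/
structure EarCore (G : SimpleGraph V) (A : Set V) (u : V) (D : Set V) : Prop where
  subset_compl : D ⊆ Aᶜ
  mem : u ∈ D
  reachIn : ∀ d ∈ D, ReachIn G D u d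
  hasEar : HasEar G A (Aᶜ \ D)

/-- The vertices outside `A ∪ D` that are adjacent to `D`. -/
def contacts (G : SimpleGraph V) (A D : Set V) : Set V :=
  {z | z ∈ Aᶜ \ D ∧ ∃ d ∈ D, G.Adj z d}

lemma EarCore.insert (hD : EarCore G A u D) (hz : z ∈ contacts G A D)
    (hear : HasEar G A ((Aᶜ \ D) \ {z})) : EarCore G A u (insert z D) where
  subset_compl := Set.insert_subset hz.1.1 hD.subset_compl
  mem := Set.mem_insert_of_mem z hD.mem
  reachIn := by
    obtain ⟨-, d, hd, hzd⟩ := hz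
    rintro x (rfl | hx)
    · exact ((hD.reachIn d hd).mono (Set.subset_insert x D)).trans
        (ReachIn.of_adj hzd.symm (Set.mem_insert_of_mem x hd) (Set.mem_insert x D))
    · exact (hD.reachIn x hx).mono (Set.subset_insert z D)
  hasEar := by rwa [← Set.union_singleton, ← Set.sdiff_sdiff]

lemma not_hasEar_of_maximal (hD : Maximal (EarCore G A u) D) (hz : z ∈ contacts G A D) :
    ¬ HasEar G A ((Aᶜ \ D) \ {z}) := fun hear =>
  hz.1.2 (hD.le_of_ge (hD.prop.insert hz hear) (Set.subset_insert z D) (Set.mem_insert z D))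

lemma EarCore.contacts_nonempty (hD : EarCore G A u D) (hA : ∀ v ∉ A, ReachIn G Aᶜ u v) :
    (contacts G A D).Nonempty := by
  obtain ⟨_, _, s, _, w, hw⟩ := hD.hasEar
  have hs := hw.mem_of_mem_support s w.start_mem_support
  obtain ⟨d, ⟨hd, -⟩, z, ⟨hzA, hzD⟩, hdz⟩ :=
    (hA s hs.1).exists_adj_of_mem_of_notMem hD.mem hs.2
  exact ⟨z, ⟨hzA, hzD⟩, d, hd, hdz.symm⟩

lemma boundary_diff_contacts_subset :
    boundary G ((Aᶜ \ D) \ contacts G A D) k ⊆ A ∪ contacts G A D := by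
  rintro d ⟨hd, x, hdx, hx⟩
  by_contra hdAZ
  rw [Set.mem_union, not_or] at hdAZ
  by_cases hdD : d ∈ D
  · exact hx.mem_left.2 ⟨hx.mem_left.1, d, hdD, hdx.symm⟩
  · exact hd ⟨⟨hdAZ.1, hdD⟩, hdAZ.2⟩

/-- `w` is the interior of an ear of `A` whose removal leaves the complement of `A` connected and
each of whose vertices has a neighbour in what remains. The vertex `u` is in what remains. -/
structure IsNonseparatingEar (G : SimpleGraph V) (A : Set V) (u a b : V) {s t : V}
    (w : G.Walk s t) : Prop extends IsEar G A Aᶜ a b w where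
  notMem_support : u ∉ w.support
  exists_adj : ∀ x ∈ w.support, ∃ d ∉ A ∪ {y | y ∈ w.support}, G.Adj x d
  reachIn : ∀ v ∉ A ∪ {y | y ∈ w.support}, ReachIn G (A ∪ {y | y ∈ w.support})ᶜ u v

lemma IsNonseparatingEar.reverse (h : IsNonseparatingEar G A u a b w) :
    IsNonseparatingEar G A u b a w.reverse where
  toIsEar := h.toIsEar.reverse
  notMem_support := by simpa using h.notMem_support
  exists_adj := by simpa using h.exists_adj
  reachIn := by simpa using h.reachIn

end NonseparatingEars

section NonseparatingEarsOfThreeConnected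

variable {V : Type} [Fintype V] {G : SimpleGraph V} {A D : Set V} {k u v : V}

lemma IsKConnected.earCore_singleton (hG : IsKConnected 3 G) (hA : A.Nontrivial)
    (hu : u ∉ A) (hk : k ∉ A) (hku : k ≠ u) : EarCore G A u {u} where
  subset_compl := Set.singleton_subset_iff.2 hu
  mem := rfl
  reachIn := by
    rintro _ rfl
    exact ReachIn.refl rfl
  hasEar := by
    have hcompl : (Aᶜ \ {u})ᶜ = insert u A := by
      rw [Set.sdiff_eq, Set.compl_inter, compl_compl, compl_compl, Set.union_singleton]
    have hcard : 3 ≤ (Aᶜ \ {u})ᶜ.ncard := by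
      have := Set.one_lt_ncard_iff_nontrivial.2 hA
      rw [hcompl, Set.ncard_insert_of_notMem hu]
      omega
    have hle := hG.le_ncard_boundary hcard ⟨hk, hku⟩
    have hpred := Set.pred_ncard_le_ncard_sdiff_singleton (boundary G (Aᶜ \ {u}) k) u
    have hmem : ∀ d ∈ boundary G (Aᶜ \ {u}) k \ {u}, d ∈ A := fun d hd => by
      by_contra hdA
      exact hd.1.1 ⟨hdA, hd.2⟩
    obtain ⟨a, ha, b, hb, hab⟩ := Set.one_lt_ncard_iff_nontrivial.1
      (show 1 < (boundary G (Aᶜ \ {u}) k \ {u}).ncard by omega)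
    exact hasEar_of_attachedIn (hmem a ha) (hmem b hb) hab ha.1.2 hb.1.2

lemma IsKConnected.mem_contacts_of_maximal (hG : IsKConnected 3 G)
    (hA : ∀ v ∉ A, ReachIn G Aᶜ u v) (hD : Maximal (EarCore G A u) D) (hv : v ∈ Aᶜ \ D) :
    v ∈ contacts G A D := by
  by_contra hvZ
  obtain ⟨a, b, s, t, w, hw⟩ := hD.prop.hasEar
  have huA : u ∉ A := hD.prop.subset_compl hD.prop.mem
  have hcompl : 3 ≤ ((Aᶜ \ D) \ contacts G A D)ᶜ.ncard :=
    (Set.two_lt_ncard).2 ⟨a, fun h => h.1.1 hw.left_mem, b, fun h => h.1.1 hw.right_mem, u,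
      fun h => h.1.2 hD.prop.mem, hw.ne, ne_of_mem_of_not_mem hw.left_mem huA,
      ne_of_mem_of_not_mem hw.right_mem huA⟩
  have hle : (boundary G ((Aᶜ \ D) \ contacts G A D) v).ncard ≤ 2 :=
    hw.ncard_boundary_le_two (hD.prop.contacts_nonempty hA) (fun z => not_hasEar_of_maximal hD)
      boundary_diff_contacts_subset
  have := hG.le_ncard_boundary hcompl ⟨hv, hvZ⟩
  omega

theorem IsKConnected.exists_isNonseparatingEar (hG : IsKConnected 3 G)
    (hA : A.Nontrivial) (hconn : ∀ v ∉ A, ReachIn G Aᶜ u v) (hu : u ∉ A) (hk : k ∉ A)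
    (hku : k ≠ u) : ∃ (a b s t : V) (w : G.Walk s t), IsNonseparatingEar G A u a b w := by
  obtain ⟨D, -, hD⟩ :=
    Finite.exists_le_maximal (hG.earCore_singleton hA hu hk hku)
  obtain ⟨a, b, s, t, w, hw⟩ := hD.prop.hasEar
  have hcontact : ∀ v ∈ Aᶜ \ D, ∃ d ∈ D, G.Adj v d := fun v hv =>
    (hG.mem_contacts_of_maximal hconn hD hv).2
  have hDcompl : D ⊆ (A ∪ {y | y ∈ w.support})ᶜ := by
    rintro d hd (hdA | hdw)
    exacts [hD.prop.subset_compl hd hdA, (hw.mem_of_mem_support d hdw).2 hd]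
  refine ⟨a, b, s, t, w, { hw with
    mem_of_mem_support := fun x hx => (hw.mem_of_mem_support x hx).1
    notMem_support := fun huw => (hw.mem_of_mem_support u huw).2 hD.prop.mem
    exists_adj := fun x hx => ?_
    reachIn := fun v hv => ?_ }⟩
  · obtain ⟨d, hd, hxd⟩ := hcontact x (hw.mem_of_mem_support x hx)
    exact ⟨d, hDcompl hd, hxd⟩
  · by_cases hvD : v ∈ D
    · exact (hD.prop.reachIn v hvD).mono hDcompl
    · obtain ⟨d, hd, hvd⟩ := hcontact v ⟨fun hvA => hv (.inl hvA), hvD⟩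
      exact ((hD.prop.reachIn d hd).mono hDcompl).trans
        (ReachIn.of_adj hvd.symm (hDcompl hd) hv)

end NonseparatingEarsOfThreeConnected

section ThreeRouting

variable {V α β : Type*} [LinearOrder α] [LinearOrder β] {G : SimpleGraph V} {R S : Set V}
  {p : V → α} {q : V → β} {a v x y : V}

/-- `v` has neighbours in three directions: one where `p` decreases and one where `p` increases,
both without increase of `q`, and one where `q` increases. -/
def HasThreeExits (G : SimpleGraph V) (p : V → α) (q : V → β) (v : V) : Prop :=
  (∃ a, G.Adj v a ∧ p a < p v ∧ q a ≤ q v) ∧ (∃ a, G.Adj v a ∧ p v < p a ∧ q a ≤ q v) ∧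
    ∃ a, G.Adj v a ∧ q v < q a

/-- Every vertex that is neither in `R` nor adjacent to `R` has three exits. Following the exits of
one direction leads to `R` or to a neighbour of `R`, and the three routes from `v` so obtained meet
outside `R` only at `v`. -/
def IsThreeRouting (G : SimpleGraph V) (R : Set V) (p : V → α) (q : V → β) : Prop :=
  ∀ v ∉ R, (∀ a ∈ R, ¬ G.Adj v a) → HasThreeExits G p q v

lemma HasThreeExits.of_lt_iff_lt {α' β' : Type*} [LinearOrder α'] [LinearOrder β'] {p' : V → α'}
    {q' : V → β'} (h : HasThreeExits G p q v) (hp : ∀ v w, p' v < p' w ↔ p v < p w)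
    (hq : ∀ v w, q' v < q' w ↔ q v < q w) : HasThreeExits G p' q' v := by
  have hq' : ∀ v w, q' v ≤ q' w ↔ q v ≤ q w := fun v w => by rw [← not_lt, hq, not_lt]
  simpa only [HasThreeExits, hp, hq, hq'] using h

lemma exists_reachIn_of_step [Finite V] {f : V → α}
    (hS : ∀ z ∈ S, z ∉ R → (∀ a ∈ R, ¬ G.Adj z a) → ∃ b ∈ S, G.Adj z b ∧ f b < f z) (hv : v ∈ S) :
    ∃ r ∈ R, ReachIn G (S ∪ R) v r := by
  obtain ⟨z, ⟨hzS, hvz⟩, hmin⟩ := Set.Finite.exists_minimalFor f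
    {z | z ∈ S ∧ ReachIn G (S ∪ R) v z} (Set.toFinite _) ⟨v, hv, ReachIn.refl (.inl hv)⟩
  by_cases hzR : z ∈ R
  · exact ⟨z, hzR, hvz⟩
  by_cases hadj : ∃ a ∈ R, G.Adj z a
  · obtain ⟨a, ha, hza⟩ := hadj
    exact ⟨a, ha, hvz.trans (ReachIn.of_adj hza hvz.mem_right (.inr ha))⟩
  · push Not at hadj
    obtain ⟨b, hb, hzb, hlt⟩ := hS z hzS hzR hadj
    have hvb := hvz.trans (ReachIn.of_adj hzb hvz.mem_right (.inl hb))
    exact absurd (hmin ⟨hb, hvb⟩ hlt.le) hlt.not_ge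

lemma IsThreeRouting.exists_reachIn_down [Finite V] (h : IsThreeRouting G R p q)
    (ha : p a < p v ∧ q a ≤ q v) :
    ∃ r ∈ R, ReachIn G ({z | p z < p v ∧ q z ≤ q v} ∪ R) a r :=
  exists_reachIn_of_step (f := p) (fun z hz hzR hadj =>
    let ⟨⟨b, hzb, hb⟩, _, _⟩ := h z hzR hadj
    ⟨b, ⟨hb.1.trans hz.1, hb.2.trans hz.2⟩, hzb, hb.1⟩) ha

lemma IsThreeRouting.exists_reachIn_up [Finite V] (h : IsThreeRouting G R p q)
    (ha : p v < p a ∧ q a ≤ q v) :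
    ∃ r ∈ R, ReachIn G ({z | p v < p z ∧ q z ≤ q v} ∪ R) a r :=
  exists_reachIn_of_step (f := OrderDual.toDual ∘ p) (fun z hz hzR hadj =>
    let ⟨_, ⟨b, hzb, hb⟩, _⟩ := h z hzR hadj
    ⟨b, ⟨hz.1.trans hb.1, hb.2.trans hz.2⟩, hzb, hb.1⟩) ha

lemma IsThreeRouting.exists_reachIn_out [Finite V] (h : IsThreeRouting G R p q)
    (ha : q v < q a) : ∃ r ∈ R, ReachIn G ({z | q v < q z} ∪ R) a r :=
  exists_reachIn_of_step (f := OrderDual.toDual ∘ q) (fun z hz hzR hadj =>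
    let ⟨_, _, b, hzb, hb⟩ := h z hzR hadj
    ⟨b, lt_trans hz hb, hzb, hb⟩) ha

lemma IsThreeRouting.nonempty [Finite V] [Nonempty V] (h : IsThreeRouting G R p q) :
    R.Nonempty := by
  obtain ⟨v⟩ := ‹Nonempty V›
  by_cases hvR : v ∈ R
  · exact ⟨v, hvR⟩
  by_cases hadj : ∃ a ∈ R, G.Adj v a
  · obtain ⟨a, ha, -⟩ := hadj
    exact ⟨a, ha⟩
  push Not at hadj
  obtain ⟨-, -, a, -, ha⟩ := h v hvR hadj
  obtain ⟨r, hr, -⟩ := h.exists_reachIn_out ha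
  exact ⟨r, hr⟩

/-- The three routes leave `v` through pairwise disjoint regions, so `x` and `y` spare one of
them. -/
lemma IsThreeRouting.exists_reachIn_compl_pair [Finite V] (h : IsThreeRouting G R p q)
    (hx : x ∉ R) (hy : y ∉ R) (hv : v ∈ ({x, y} : Set V)ᶜ) : ∃ r ∈ R, ReachIn G {x, y}ᶜ v r := by
  by_cases hvR : v ∈ R
  · exact ⟨v, hvR, ReachIn.refl hv⟩
  have hR : R ⊆ {x, y}ᶜ := by
    rintro r hr (rfl | rfl)
    exacts [hx hr, hy hr]
  by_cases hadj : ∃ a ∈ R, G.Adj v a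
  · obtain ⟨a, ha, hva⟩ := hadj
    exact ⟨a, ha, ReachIn.of_adj hva hv (hR ha)⟩
  push Not at hadj
  obtain ⟨⟨a, hva, ha⟩, ⟨b, hvb, hb⟩, c, hvc, hc⟩ := h v hvR hadj
  by_contra hnot
  have hmeets : ∀ {S : Set V} {z : V}, G.Adj v z → z ∈ S →
      (∃ r ∈ R, ReachIn G (S ∪ R) z r) → x ∈ S ∨ y ∈ S := by
    rintro S z hvz hz ⟨r, hr, hzr⟩
    by_contra! hS
    have hSxy : S ⊆ {x, y}ᶜ := by
      rintro d hd (rfl | rfl)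
      exacts [hS.1 hd, hS.2 hd]
    exact hnot ⟨r, hr, (ReachIn.of_adj hvz hv (hSxy hz)).trans
      (hzr.mono (Set.union_subset hSxy hR))⟩
  have hdown := hmeets hva ha (h.exists_reachIn_down ha)
  have hup := hmeets hvb hb (h.exists_reachIn_up hb)
  have hout := hmeets hvc hc (h.exists_reachIn_out hc)
  simp only [Set.mem_ofPred_eq] at hdown hup hout
  grind

/-- Two removed vertices spare two of the four roots, hence one from which everything is reached. -/
theorem isKConnected_three_of_isThreeRouting {V : Type} [Fintype V] {G : SimpleGraph V}
    {r : Fin 4 → V} (hr : r.Injective) {p : Fin 4 → V → α} {q : Fin 4 → V → β}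
    (h : ∀ j, IsThreeRouting G {r j} (p j) (q j)) : IsKConnected 3 G := by
  classical
  refine ⟨by simpa [Nat.succ_le_iff] using Fintype.card_le_of_injective r hr, fun X hX => ?_⟩
  obtain ⟨x, y, -, rfl⟩ := Finset.card_eq_two.1 (Nat.succ_injective hX)
  obtain ⟨j, hj⟩ : ∃ j, r j ∉ ({x, y} : Finset V) := by
    by_contra! hmem
    have hcard := Finset.card_le_card_of_injOn r (s := Finset.univ) (fun j _ => hmem j) hr.injOn
    rw [Finset.card_univ, Fintype.card_fin, Nat.succ_injective hX] at hcard
    omega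
  simp only [Finset.mem_insert, Finset.mem_singleton, not_or] at hj
  have hcompl : {v | v ∉ ({x, y} : Finset V)} = ({x, y} : Set V)ᶜ := by ext; simp
  rw [hcompl]
  refine connected_induce_of_reachIn (t := r j) (by simpa using hj) fun v hv => ?_
  obtain ⟨_, rfl, hvr⟩ := (h j).exists_reachIn_compl_pair (Ne.symm hj.1) (Ne.symm hj.2) hv
  exact hvr.symm

end ThreeRouting

section PartialRouting

/-- The new values fit between `f a` and the next value of `f` on `A`. -/
lemma exists_eqOn_injOn_strictMonoOn_comp {V α : Type*} [LinearOrder α] [DenselyOrdered α]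
    {f : V → α} {A : Set V} (hA : A.Finite) (hf : A.InjOn f) {a b : V} (hb : b ∈ A)
    (hab : f a < f b) {x : ℕ → V} {n : ℕ} (hx : (Set.Iic n).InjOn x) (hxA : ∀ i ≤ n, x i ∉ A) :
    ∃ g : V → α, A.EqOn g f ∧ (A ∪ x '' Set.Iic n).InjOn g ∧ StrictMonoOn (g ∘ x) (Set.Iic n) ∧
      ∀ i ≤ n, f a < g (x i) ∧ g (x i) < f b := by
  classical
  obtain ⟨c, ⟨-, hac⟩, hc⟩ := Set.exists_min_image {v | v ∈ A ∧ f a < f v} f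
    (hA.subset fun v hv => hv.1) ⟨b, hb, hab⟩
  have : Nonempty (Set.Ioo (f a) (f c)) := (Set.nonempty_Ioo.2 hac).to_subtype
  obtain ⟨h, hh⟩ := Nat.exists_strictMono (Set.Ioo (f a) (f c))
  set g : V → α := fun v => if v ∈ A then f v else h (Function.invFunOn x (Set.Iic n) v) with hg
  have hgA : A.EqOn g f := fun v hv => if_pos hv
  have hgx : ∀ i ≤ n, g (x i) = h i := fun i hi => by
    simp only [hg, if_neg (hxA i hi), hx.leftInvOn_invFunOn hi]
  have hmono : StrictMonoOn (g ∘ x) (Set.Iic n) := fun i hi j hj hij => by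
    rw [Function.comp_apply, Function.comp_apply, hgx i hi, hgx j hj]
    exact hh hij
  have hIoo : ∀ i ≤ n, g (x i) ∈ Set.Ioo (f a) (f c) := fun i hi => hgx i hi ▸ (h i).2
  refine ⟨g, hgA, (Set.injOn_union ?_).2 ⟨hgA.injOn_iff.2 hf, hmono.injOn.image_of_comp, ?_⟩,
    hmono, fun i hi => ⟨(hIoo i hi).1, (hIoo i hi).2.trans_le (hc b ⟨hb, hab⟩)⟩⟩
  · rw [Set.disjoint_right]
    rintro _ ⟨i, hi, rfl⟩
    exact hxA i hi
  · rintro v hv _ ⟨i, hi, rfl⟩ heq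
    rw [hgA hv] at heq
    exact (hIoo i hi).2.not_ge (heq ▸ hc v ⟨hv, heq ▸ (hIoo i hi).1⟩)

variable {V α β : Type*} [LinearOrder α] [LinearOrder β] {G : SimpleGraph V}

lemma HasThreeExits.of_eqOn {p p' : V → α} {q q' : V → β} {v : V} (h : HasThreeExits G p q v)
    (hp : {z | q z ≤ q v}.EqOn p' p) (hq : {z | q z ≤ q v}.EqOn q' q)
    (hout : ∀ z, q v < q z → q v < q' z) : HasThreeExits G p' q' v := by
  obtain ⟨⟨a, hva, hpa, hqa⟩, ⟨b, hvb, hpb, hqb⟩, c, hvc, hqc⟩ := h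
  have hpv := hp (le_refl (q v))
  have hqv := hq (le_refl (q v))
  refine ⟨⟨a, hva, ?_, ?_⟩, ⟨b, hvb, ?_, ?_⟩, c, hvc, hqv ▸ hout c hqc⟩
  · rwa [hpv, hp hqa]
  · rwa [hqv, hq hqa]
  · rwa [hpv, hp hqb]
  · rwa [hqv, hq hqb]

lemma hasThreeExits_getVert {p : V → α} {q : V → β} {a b s t : V} {w : G.Walk s t}
    (has : G.Adj a s) (hbt : G.Adj b t) (hmono : StrictMonoOn (p ∘ w.getVert) (Set.Iic w.length))
    {m : β} (hq : ∀ i, q (w.getVert i) = m) (hqa : q a ≤ m) (hqb : q b ≤ m)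
    {i : ℕ} (hi : i ≤ w.length) (hpa : p a < p (w.getVert i)) (hpb : p (w.getVert i) < p b)
    (hout : ∃ d, G.Adj (w.getVert i) d ∧ m < q d) : HasThreeExits G p q (w.getVert i) := by
  refine ⟨?_, ?_, by rwa [hq]⟩
  · rcases i.eq_zero_or_pos with rfl | hpos
    · exact ⟨a, by simpa using has.symm, hpa, (hq 0).symm ▸ hqa⟩
    · refine ⟨w.getVert (i - 1), ?_, hmono (show i - 1 ≤ w.length by omega) hi (by omega),
        by simp [hq]⟩
      simpa [Nat.sub_add_cancel hpos] using (w.adj_getVert_succ (i := i - 1) (by omega)).symm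
  · rcases hi.eq_or_lt with rfl | hlt
    · exact ⟨b, by simpa using hbt.symm, hpb, (hq _).symm ▸ hqb⟩
    · exact ⟨w.getVert (i + 1), w.adj_getVert_succ hlt, hmono hi hlt i.lt_succ_self, by simp [hq]⟩

end PartialRouting

section Construction

variable {V : Type*} {G : SimpleGraph V} {A : Set V} {r u v z a b s t : V} {w : G.Walk s t}
  {p : V → ℚ} {q : V → ℕ} {m : ℕ}

/-- The state of the construction of a three-routing with root `r` when the vertices of `A` have
been placed. What is left is connected, contains `u` and lies above `A` in `q`. -/
structure PartialRouting (G : SimpleGraph V) (r u : V) (A : Set V) (p : V → ℚ) (q : V → ℕ)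
    (m : ℕ) : Prop where
  nontrivial : A.Nontrivial
  notMem : u ∉ A
  reachIn : ∀ v ∉ A, ReachIn G Aᶜ u v
  injOn : A.InjOn p
  lt_of_mem : ∀ v ∈ A, q v < m
  eq_of_notMem : ∀ v ∉ A, q v = m
  hasThreeExits : ∀ v ∈ A, v ≠ r → ¬ G.Adj v r → HasThreeExits G p q v

lemma PartialRouting.mem_of_le (h : PartialRouting G r u A p q m) (hv : v ∈ A)
    (hz : q z ≤ q v) : z ∈ A := by
  by_contra hzA
  have := h.lt_of_mem v hv
  have := h.eq_of_notMem z hzA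
  omega

lemma PartialRouting.le (h : PartialRouting G r u A p q m) (v : V) : q v ≤ m := by
  by_cases hv : v ∈ A
  exacts [(h.lt_of_mem v hv).le, (h.eq_of_notMem v hv).le]

lemma setOf_mem_support_eq_image_getVert (w : G.Walk s t) :
    {y | y ∈ w.support} = w.getVert '' Set.Iic w.length := by
  ext y
  simp [Walk.mem_support_iff_exists_getVert, and_comm]

lemma PartialRouting.add_ear_of_lt [Finite V] (h : PartialRouting G r u A p q m)
    (hw : IsNonseparatingEar G A u a b w) (hab : p a < p b) :
    ∃ p' q', PartialRouting G r u (A ∪ {y | y ∈ w.support}) p' q' (m + 1) := by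
  classical
  have hwA : ∀ i, w.getVert i ∉ A := fun i => hw.mem_of_mem_support _ (w.getVert_mem_support i)
  obtain ⟨p', hp', hinj, hmono, hbetween⟩ := exists_eqOn_injOn_strictMonoOn_comp A.toFinite h.injOn
    hw.right_mem hab hw.isPath.getVert_injOn fun i _ => hwA i
  set A' := A ∪ {y | y ∈ w.support} with hA'
  set q' : V → ℕ := fun v => if v ∈ A' then q v else m + 1
  have hqA' : A'.EqOn q' q := fun v hv => if_pos hv
  have hqout : ∀ v ∉ A', q' v = m + 1 := fun v hv => if_neg hv
  have hqw : ∀ i, q' (w.getVert i) = m := fun i =>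
    (hqA' (.inr (w.getVert_mem_support i))).trans (h.eq_of_notMem _ (hwA i))
  refine ⟨p', q', h.nontrivial.mono Set.subset_union_left, ?_, hw.reachIn, ?_, ?_, hqout, ?_⟩
  · rintro (huA | huw)
    exacts [h.notMem huA, hw.notMem_support huw]
  · rwa [hA', setOf_mem_support_eq_image_getVert]
  · intro v hv
    rw [hqA' hv]
    exact Nat.lt_succ_of_le (h.le v)
  · rintro v (hv | hv) hvr hvadj
    · refine (h.hasThreeExits v hv hvr hvadj).of_eqOn (fun z hz => hp' (h.mem_of_le hv hz))
        (fun z hz => hqA' (.inl (h.mem_of_le hv hz))) fun z hz => ?_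
      by_cases hzA' : z ∈ A'
      · rwa [hqA' hzA']
      · exact (hqout z hzA').symm ▸ Nat.lt_succ_of_le (h.le v)
    · rw [setOf_mem_support_eq_image_getVert] at hv
      obtain ⟨i, hi, rfl⟩ := hv
      obtain ⟨d, hd, hwd⟩ := hw.exists_adj _ (w.getVert_mem_support i)
      refine hasThreeExits_getVert hw.adj_left hw.adj_right hmono hqw ?_ ?_ hi ?_ ?_
        ⟨d, hwd, (hqout d hd).symm ▸ m.lt_succ_self⟩
      · exact (hqA' (.inl hw.left_mem)).trans_le (h.le a)
      · exact (hqA' (.inl hw.right_mem)).trans_le (h.le b)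
      · exact hp' hw.left_mem ▸ (hbetween i hi).1
      · exact hp' hw.right_mem ▸ (hbetween i hi).2

lemma PartialRouting.add_ear [Finite V] (h : PartialRouting G r u A p q m)
    (hw : IsNonseparatingEar G A u a b w) :
    ∃ p' q', PartialRouting G r u (A ∪ {y | y ∈ w.support}) p' q' (m + 1) := by
  rcases (h.injOn.ne hw.left_mem hw.right_mem hw.ne).lt_or_gt with hab | hba
  · exact h.add_ear_of_lt hw hab
  · simpa using h.add_ear_of_lt hw.reverse hba

lemma exists_le_card_and_lt_iff_lt [Fintype V] {α : Type*} [LinearOrder α] (f : V → α) :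
    ∃ g : V → ℕ, (∀ v, g v ≤ Fintype.card V) ∧ ∀ v w, g v < g w ↔ f v < f w := by
  classical
  have hmono : ∀ v w, f v ≤ f w → ({x | f x < f v} : Finset V) ⊆ ({x | f x < f w} : Finset V) :=
    fun v w hvw => Finset.monotone_filter_right _ fun x _ hx => lt_of_lt_of_le hx hvw
  refine ⟨fun v => ({x | f x < f v} : Finset V).card, fun v => Finset.card_le_univ _,
    fun v w => ⟨fun h => ?_, fun h => ?_⟩⟩
  · contrapose! h
    exact Finset.card_le_card (hmono w v h)
  · exact Finset.card_lt_card ((hmono v w h.le).ssubset_of_mem_notMem (by simpa using h) (by simp))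

end Construction

section ConstructionOfThreeConnected

variable {V : Type} [Fintype V] {G : SimpleGraph V} {A : Set V} {r u : V} {p : V → ℚ} {q : V → ℕ}
  {m : ℕ}

lemma PartialRouting.exists_compl_singleton (hG : IsKConnected 3 G)
    (h : PartialRouting G r u A p q m) :
    ∃ p' q' m', PartialRouting G r u {u}ᶜ p' q' m' := by
  induction A using WellFoundedGT.induction generalizing p q m with
  | ind A ih =>
    by_cases hA : A = {u}ᶜ
    · exact ⟨p, q, m, hA ▸ h⟩
    obtain ⟨k, hku, hk⟩ : ∃ k, k ≠ u ∧ k ∉ A := by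
      by_contra! hk
      exact hA (Set.Subset.antisymm (fun v hv hvu => h.notMem (hvu ▸ hv)) hk)
    obtain ⟨a, b, s, t, w, hw⟩ :=
      hG.exists_isNonseparatingEar h.nontrivial h.reachIn h.notMem hk hku
    obtain ⟨p', q', h'⟩ := h.add_ear hw
    exact ih _ (Set.subset_union_left.ssubset_of_mem_notMem (.inr w.start_mem_support)
      (hw.mem_of_mem_support s w.start_mem_support)) h'

theorem IsKConnected.exists_isThreeRouting (hG : IsKConnected 3 G) (r : V) :
    ∃ p q : V → ℕ, (∀ v, p v ≤ Fintype.card V) ∧ (∀ v, q v ≤ Fintype.card V) ∧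
      IsThreeRouting G {r} p q := by
  classical
  obtain ⟨t, hrt, u, hru, htu⟩ := hG.nontrivial_neighborSet r
  have hconn : ∀ v ∉ ({r, t} : Set V), ReachIn G {r, t}ᶜ u v := fun v hv =>
    (hG.reachIn_compl (X := {r, t}) (Finset.card_le_two.trans_lt (by norm_num))
      (by simp [hru.ne', htu.symm]) (by simpa using hv)).mono fun x hx => by simpa using hx
  have hstart : PartialRouting G r u {r, t} (fun v => if v = r then 0 else 1)
      (fun v => if v ∈ ({r, t} : Set V) then 0 else 1) 1 := by
    refine ⟨Set.nontrivial_pair hrt.ne, by simp [hru.ne', htu.symm], hconn, ?_,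
      fun v hv => by simp [hv], fun v hv => by simp [hv], ?_⟩
    · rintro x (rfl | rfl) y (rfl | rfl) <;> simp [hrt.ne, hrt.ne']
    · rintro v (rfl | rfl) hvr hadj
      exacts [absurd rfl hvr, absurd hrt.symm hadj]
  obtain ⟨p, q, m, h⟩ := hstart.exists_compl_singleton hG
  obtain ⟨p', hp'card, hp'⟩ := exists_le_card_and_lt_iff_lt p
  obtain ⟨q', hq'card, hq'⟩ := exists_le_card_and_lt_iff_lt q
  refine ⟨p', q', hp'card, hq'card, fun v hvr hadj => ?_⟩
  have hvu : v ∈ ({u}ᶜ : Set V) := by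
    rintro rfl
    exact hadj r rfl hru.symm
  exact (h.hasThreeExits v hvu hvr (hadj r rfl)).of_lt_iff_lt hp' hq'

end ConstructionOfThreeConnected

section Encoding

lemma size_pair_le {a b s : ℕ} (ha : a.size ≤ s) (hb : b.size ≤ s) :
    (Nat.pair a b).size ≤ 2 * s := by
  rw [Nat.size_le] at *
  calc Nat.pair a b < (max a b + 1) ^ 2 := Nat.pair_lt_max_add_one_sq a b
    _ ≤ (2 ^ s) ^ 2 := Nat.pow_le_pow_left (max_lt ha hb) 2
    _ = 2 ^ (2 * s) := by rw [← pow_mul, mul_comm]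

/-- Encodes a tuple of natural numbers as a single one, by iterated pairing. -/
def pack : {n : ℕ} → (Fin n → ℕ) → ℕ
  | 0, _ => 0
  | _ + 1, x => Nat.pair (x 0) (pack (Fin.tail x))

lemma pack_injective (n : ℕ) : (pack (n := n)).Injective := by
  induction n with
  | zero => exact Function.injective_of_subsingleton _
  | succ n ih =>
    intro x y hxy
    obtain ⟨hhead, htail⟩ := Nat.pair_eq_pair.1 hxy
    rw [← Fin.cons_self_tail x, ← Fin.cons_self_tail y, hhead, ih htail]

lemma size_pack_le {n s : ℕ} {x : Fin n → ℕ} (hx : ∀ i, (x i).size ≤ s) :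
    (pack x).size ≤ 2 ^ n * s := by
  induction n with
  | zero => simp [pack]
  | succ n ih =>
    calc (pack x).size ≤ 2 * (2 ^ n * s) :=
          size_pair_le ((hx 0).trans (Nat.le_mul_of_pos_left s (by positivity)))
            (ih fun i => hx i.succ)
      _ = 2 ^ (n + 1) * s := by ring

lemma bits_injective : Nat.bits.Injective := fun a b hab => by
  rw [← Nat.ofDigits_digits 2 a, ← Nat.ofDigits_digits 2 b, Nat.digits_two_eq_bits,
    Nat.digits_two_eq_bits, hab]

/-- What a vertex is told about one three-routing: the identifier of the root and the values of
the two orders, `height` for `p` and `depth` for `q`, at the vertex. -/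
@[ext]
structure Mark where
  root : ℕ
  height : ℕ
  depth : ℕ

instance : Inhabited Mark := ⟨⟨0, 0, 0⟩⟩

/-- The label that carries one mark for each of four three-routings. -/
def encode (m : Fin 4 → Mark) : Label :=
  (pack fun j => pack ![(m j).root, (m j).height, (m j).depth]).bits

lemma encode_injective : encode.Injective := fun m m' h => by
  funext j
  have hj := pack_injective 3 (congrFun (pack_injective 4 (bits_injective h)) j)
  exact Mark.ext (congrFun hj 0) (congrFun hj 1) (congrFun hj 2)

lemma length_encode_le {m : Fin 4 → Mark} {s : ℕ} (hroot : ∀ j, (m j).root.size ≤ s)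
    (hheight : ∀ j, (m j).height.size ≤ s) (hdepth : ∀ j, (m j).depth.size ≤ s) :
    (encode m).length ≤ 128 * s := by
  have hmark : ∀ j, (pack ![(m j).root, (m j).height, (m j).depth]).size ≤ 2 ^ 3 * s := fun j =>
    size_pack_le (Fin.forall_fin_succ.2 ⟨hroot j, Fin.forall_fin_two.2 ⟨hheight j, hdepth j⟩⟩)
  rw [encode, Nat.size_eq_bits_len]
  exact (size_pack_le hmark).trans_eq (by ring)

/-- The marks that a label carries; an arbitrary value on a label that is not in the range of
`encode`. -/
noncomputable def decode : Label → Fin 4 → Mark :=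
  Function.invFun encode

@[simp]
lemma decode_encode (m : Fin 4 → Mark) : decode (encode m) = m :=
  Function.leftInverse_invFun encode_injective m

end Encoding

section Certification

/-- Each vertex checks that the four roots are distinct, that its neighbours agree with it on their
identifiers, and that it has three exits for each root that it neither is nor neighbours. -/
def verifier : Verifier := fun x =>
  (fun j => (decode x.label j).root).Injective ∧
  ∀ j, let m := decode x.label j
    (∀ n ∈ x.nbrs, (decode n.2.1 j).root = m.root) ∧
    (x.ident ≠ m.root → (∀ n ∈ x.nbrs, n.1 ≠ m.root) →
      (∃ n ∈ x.nbrs, (decode n.2.1 j).height < m.height ∧ (decode n.2.1 j).depth ≤ m.depth) ∧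
      (∃ n ∈ x.nbrs, m.height < (decode n.2.1 j).height ∧ (decode n.2.1 j).depth ≤ m.depth) ∧
      ∃ n ∈ x.nbrs, m.depth < (decode n.2.1 j).depth)

lemma eq_of_connected {V α : Type*} {G : SimpleGraph V} (hG : G.Connected) {f : V → α}
    (hf : ∀ v w, G.Adj v w → f w = f v) (v w : V) : f v = f w := by
  obtain ⟨p⟩ := hG.preconnected v w
  induction p with
  | nil => rfl
  | cons h _ ih => exact (hf _ _ h).symm.trans ih

variable {V : Type} {G : SimpleGraph V} {ident : V → ℕ} {c : V → Label} {e : Sym2 V → Label}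

lemma forall_mem_nbrs_view {v : V} {P : ℕ × Label × Label → Prop} :
    (∀ n ∈ (view G ident c e v).nbrs, P n) ↔
      ∀ w, G.Adj v w → P (ident w, c w, e s(v, w)) :=
  ⟨fun h w hvw => h _ ⟨w, hvw, rfl⟩, fun h _ ⟨w, hvw, hn⟩ => hn ▸ h w hvw⟩

lemma exists_mem_nbrs_view {v : V} {P : ℕ × Label × Label → Prop} :
    (∃ n ∈ (view G ident c e v).nbrs, P n) ↔
      ∃ w, G.Adj v w ∧ P (ident w, c w, e s(v, w)) :=
  ⟨fun ⟨_, ⟨w, hvw, hn⟩, h⟩ => ⟨w, hvw, hn ▸ h⟩, fun ⟨w, hvw, h⟩ => ⟨_, ⟨w, hvw, rfl⟩, h⟩⟩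

lemma verifier_view_iff {v : V} : verifier (view G ident c e v) ↔
    (fun j => (decode (c v) j).root).Injective ∧
    ∀ j, (∀ w, G.Adj v w → (decode (c w) j).root = (decode (c v) j).root) ∧
      (ident v ≠ (decode (c v) j).root →
        (∀ w, G.Adj v w → ident w ≠ (decode (c v) j).root) →
        HasThreeExits G (fun w => (decode (c w) j).height)
          (fun w => (decode (c w) j).depth) v) := by
  simp only [verifier, forall_mem_nbrs_view, exists_mem_nbrs_view]
  rfl

theorem accepts_verifier_iff (hG : G.Connected) : verifier.Accepts G ident c e ↔
    ∃ r : Fin 4 → ℕ, r.Injective ∧ ∀ j, (∀ v, (decode (c v) j).root = r j) ∧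
      IsThreeRouting G (ident ⁻¹' {r j}) (fun v => (decode (c v) j).height)
        (fun v => (decode (c v) j).depth) := by
  simp only [Verifier.Accepts, verifier_view_iff]
  constructor
  · intro h
    obtain ⟨o⟩ := hG.nonempty
    have hroot : ∀ j v, (decode (c v) j).root = (decode (c o) j).root := fun j v =>
      eq_of_connected hG (fun v w => ((h v).2 j).1 w) v o
    refine ⟨_, (h o).1, fun j => ⟨hroot j, fun v hv hadj => ((h v).2 j).2 ?_ ?_⟩⟩
    · rwa [hroot j v]
    · rw [hroot j v]
      exact fun w hvw hw => hadj w hw hvw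
  · rintro ⟨r, hr, h⟩ v
    refine ⟨by simpa only [(h _).1 v] using hr, fun j => ⟨fun w _ => ?_, ?_⟩⟩
    · rw [(h j).1 w, (h j).1 v]
    · rw [(h j).1 v]
      exact fun hv hadj => (h j).2 v hv fun w hw hvw => hadj w hvw hw

variable [Fintype V]

theorem isKConnected_three_of_accepts (hG : G.Connected) (hident : ident.Injective)
    (h : verifier.Accepts G ident c e) : IsKConnected 3 G := by
  have := hG.nonempty
  obtain ⟨r, hr, hrouting⟩ := (accepts_verifier_iff hG).1 h
  choose root hroot using fun j => (hrouting j).2.nonempty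
  have hpreimage : ∀ j, ident ⁻¹' {r j} = {root j} := fun j =>
    Set.eq_singleton_iff_unique_mem.2 ⟨hroot j, fun v hv => hident (hv.trans (hroot j).symm)⟩
  have hinj : root.Injective := fun i j hij => hr ((hroot i).symm.trans (hij ▸ hroot j))
  exact isKConnected_three_of_isThreeRouting hinj fun j => hpreimage j ▸ (hrouting j).2

theorem IsKConnected.exists_accepts {k : ℕ} (hG : IsKConnected 3 G) (hconn : G.Connected)
    (hident : IsIdent k ident) (e : Sym2 V → Label) :
    ∃ c : V → Label, (∀ v, (c v).length ≤ 128 * (Fintype.card V ^ (k + 1)).size) ∧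
      verifier.Accepts G ident c e := by
  obtain ⟨root⟩ : Nonempty (Fin 4 ↪ V) :=
    Function.Embedding.nonempty_of_card_le (by simpa [Nat.succ_le_iff] using hG.1)
  choose p q hp hq h using fun j => hG.exists_isThreeRouting (root j)
  have hpreimage : ∀ j, ident ⁻¹' {ident (root j)} = {root j} := fun j => by
    simp [← Set.image_singleton, Set.preimage_image_eq _ hident.1]
  refine ⟨fun v => encode fun j => ⟨ident (root j), p j v, q j v⟩, fun v => ?_,
    (accepts_verifier_iff hconn).2 ⟨fun j => ident (root j), hident.1.comp root.injective,
      fun j => ⟨by simp, by simpa [hpreimage] using h j⟩⟩⟩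
  have hrank : ∀ {n}, n ≤ Fintype.card V → n.size ≤ (Fintype.card V ^ (k + 1)).size := fun hn =>
    Nat.size_le_size (hn.trans (Nat.le_self_pow k.succ_ne_zero _))
  exact length_encode_le (fun j => Nat.size_le_size ((hident.2 _).2.trans
    (Nat.pow_le_pow_right (Nat.zero_lt_of_lt hG.1) k.le_succ)))
    (fun j => hrank (hp j v)) fun j => hrank (hq j v)

lemma isBigO_size_pow_log (k : ℕ) :
    (fun n : ℕ => ((n ^ k).size : ℝ)) =O[Filter.atTop] fun n : ℕ => Real.log n := by
  have hsize : ∀ m : ℕ, (m.size : ℝ) ≤ Real.logb 2 m + 1 := fun m => by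
    have hm : m.size ≤ Nat.log 2 m + 1 := Nat.size_le.2 (Nat.lt_pow_succ_log_self one_lt_two _)
    calc (m.size : ℝ) ≤ Nat.log 2 m + 1 := by exact_mod_cast hm
      _ ≤ Real.logb 2 m + 1 := by simpa using Real.natLog_le_logb m 2
  have hbound : (fun n : ℕ => ((n ^ k).size : ℝ)) =O[Filter.atTop]
      fun n : ℕ => k / Real.log 2 * Real.log n + 1 :=
    Asymptotics.isBigO_of_le _ fun n => by
      have := hsize (n ^ k)
      rw [Nat.cast_pow, Real.logb, Real.log_pow, mul_div_right_comm] at this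
      rw [Real.norm_of_nonneg (by positivity)]
      exact this.trans (le_abs_self _)
  have hone : (fun _ : ℕ => (1 : ℝ)) =O[Filter.atTop] fun n : ℕ => Real.log n :=
    Real.isLittleO_const_log_atTop.isBigO.comp_tendsto tendsto_natCast_atTop_atTop
  exact hbound.trans (((Asymptotics.isBigO_refl _ _).const_mul_left _).add hone)

end Certification
end LocalCert

open LocalCert in
theorem mainTheorem8_general (k : ℕ) :
    ∃ f : ℕ → ℕ, (fun n => (f n : ℝ)) =O[Filter.atTop] (fun n : ℕ => Real.log (n : ℝ)) ∧
      CertifiableWith k (fun {V} [Fintype V] (G : SimpleGraph V) => IsKConnected 3 G)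
        f fun _ => 0 := by
  refine ⟨fun n => 128 * (n ^ (k + 1)).size,
    by simpa using (isBigO_size_pow_log (k + 1)).const_mul_left 128, verifier,
    fun V _ G ident hconn hident => ⟨fun hG => ?_, fun hG c e h =>
      hG (isKConnected_three_of_accepts hconn hident.1 h)⟩⟩
  obtain ⟨c, hc, h⟩ := IsKConnected.exists_accepts hG hconn hident fun _ => []
  exact ⟨c, fun _ => [], hc, fun _ _ => le_rfl, h⟩

theorem mainTheorem8 (k : ℕ) :
    ∃ f g : ℕ → ℕ,
      (fun n => (f n : ℝ)) =O[Filter.atTop] (fun n : ℕ => Real.log (n : ℝ)) ∧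
      (fun n => (g n : ℝ)) =O[Filter.atTop] (fun _ : ℕ => (1 : ℝ)) ∧
      LocalCert.CertifiableWith k (fun {V} [Fintype V] (G : SimpleGraph V) =>
        LocalCert.IsKConnected 3 G) f g := by
  obtain ⟨f, hf, hcert⟩ := mainTheorem8_general k
  exact ⟨f, fun _ => 0, hf, Asymptotics.isBigO_const_const _ one_ne_zero _, hcert⟩
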